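/- All rings are commutative with $1$. For a free $R$-module $M$, an element $v\in M$ is unimodular, written $v\in Um(M)$, if some $R$-linear form $M\to R$ takes the value $1$ on $v$. A ring $R$ is a Hermite ring if $R^2=R\cdot Um(R^2)$. A ring $R$ is an elementary divisor ring (EDR) if for all integers $m,n\ge 1$ and every $m\times n$ matrix $A$ over $R$ there exist $P\in GL_m(R)$ and $Q\in GL_n(R)$ such that $PAQ$ has zero off-diagonal entries and each of its diagonal entries divides the next one. An elementary divisor domain (EDD) is an integral domain which is an EDR. A matrix $A\in Um(\mathbb M_2(R))$ is extendable if it is obtained from some matrix in $SL_3(R)$ by removing the third row and the third column. In $\mathbb M_2(\mathbb Z[x,y,z])$ let $$\mathcal D=\begin{bmatrix} x(1-yz) & y\\ 0 & (1-x)(1-yz)\end{bmatrix},\qquad \mathcal F=\begin{bmatrix} x & y\\ 0 & (1-x)(1-yz)\end{bmatrix}.$$ Then $\mathcal D,\mathcal F\in Um(\mathbb M_2(\mathbb Z[x,y,z]))$, and the following hold. (1) Let $R$ be a Hermite ring. Then $R$ is an EDR if and only if for every ring homomorphism $\phi:\mathbb Z[x,y,z]\to R$ the image $\phi(\mathcal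 D)\in\mathbb M_2(R)$ is extendable. Likewise, $R$ is an EDR if and only if for every ring homomorphism $\phi:\mathbb Z[x,y,z]\to R$ the image $\phi(\mathcal F)\in\mathbb M_2(R)$ is extendable. (2) Let $R$ be a Bézout domain, i.e., an integral domain all of whose finitely generated ideals are principal. Then $R$ is an EDD if and only if for all $(a,u,t)\in R^3$ with $u\neq 0$ there exists $(s,l,z)\in R^3$ such that $$(1-us-al)^2+l-usl-al^2-(s+t-ust)z=0.$$ -/

import Mathlib

namespace HermiteExt

/-- An element `v` of a (free) `R`-module is unimodular if some linear form takes the value `1`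
on it. -/
def IsUnimodular (R : Type*) {M : Type*} [CommRing R] [AddCommGroup M] [Module R M] (v : M) :
    Prop :=
  ∃ f : M →ₗ[R] R, f v = 1

/-- Hermite rings in the sense of Kaplansky: `R² = R · Um(R²)`. -/
def IsHermiteRing (R : Type*) [CommRing R] : Prop :=
  ∀ v : Fin 2 → R, ∃ (r : R) (w : Fin 2 → R), IsUnimodular R w ∧ v = r • w

/-- A rectangular matrix is a divisibility-ordered diagonal matrix if its off-diagonal entries
are `0` and each diagonal entry divides the next one. -/
def IsDivisorDiagonal {R : Type*} [CommRing R] {m n : ℕ} (B : Matrix (Fin m) (Fin n) R) : Prop :=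
  (∀ (i : Fin m) (j : Fin n), (i : ℕ) ≠ (j : ℕ) → B i j = 0) ∧
  ∀ (k : ℕ) (hm : k + 1 < m) (hn : k + 1 < n),
    B ⟨k, Nat.lt_of_succ_lt hm⟩ ⟨k, Nat.lt_of_succ_lt hn⟩ ∣ B ⟨k + 1, hm⟩ ⟨k + 1, hn⟩

/-- A matrix admits diagonal reduction if it is equivalent to a divisibility-ordered diagonal
matrix. -/
def AdmitsDiagonalReduction {R : Type*} [CommRing R] {m n : ℕ} (A : Matrix (Fin m) (Fin n) R) :
    Prop :=
  ∃ (P : Matrix.GeneralLinearGroup (Fin m) R) (Q : Matrix.GeneralLinearGroup (Fin n) R),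
    IsDivisorDiagonal
      ((P : Matrix (Fin m) (Fin m) R) * A * (Q : Matrix (Fin n) (Fin n) R))

/-- Elementary divisor rings: every matrix of positive size admits diagonal reduction. -/
def IsEDR (R : Type*) [CommRing R] : Prop :=
  ∀ m n : ℕ, 1 ≤ m → 1 ≤ n → ∀ A : Matrix (Fin m) (Fin n) R, AdmitsDiagonalReduction A

/-- Elementary divisor domains. -/
def IsEDD (R : Type*) [CommRing R] : Prop :=
  IsDomain R ∧ IsEDR R

/-- A unimodular `2 × 2` matrix is extendable if it is obtained from a matrix in `SL₃(R)` by
removing the third row and the third column. -/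
def IsExtendable {R : Type*} [CommRing R] (A : Matrix (Fin 2) (Fin 2) R) : Prop :=
  IsUnimodular R A ∧
  ∃ Aplus : Matrix.SpecialLinearGroup (Fin 3) R,
    A = (Aplus : Matrix (Fin 3) (Fin 3) R).submatrix Fin.castSucc Fin.castSucc

/-- The polynomial ring `ℤ[x, y, z]`, with `x`, `y`, `z` the variables of index `0`, `1`, `2`. -/
abbrev Zxyz : Type := MvPolynomial (Fin 3) ℤ

/-- The variable `x`. -/
noncomputable def varX : Zxyz := MvPolynomial.X 0

/-- The variable `y`. -/
noncomputable def varY : Zxyz := MvPolynomial.X 1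

/-- The variable `z`. -/
noncomputable def varZ : Zxyz := MvPolynomial.X 2

/-- The first universal test matrix for Hermite rings. -/
noncomputable def matD : Matrix (Fin 2) (Fin 2) Zxyz :=
  !![varX * (1 - varY * varZ), varY;
     0, (1 - varX) * (1 - varY * varZ)]

/-- The second universal test matrix for Hermite rings. -/
noncomputable def matF : Matrix (Fin 2) (Fin 2) Zxyz :=
  !![varX, varY;
     0, (1 - varX) * (1 - varY * varZ)]

end HermiteExt

namespace HermiteExt

open Matrix

variable {R : Type*} [CommRing R]

/-! ### Unimodular vectors and matrices of small size -/

/-! Everything is read off the bilinear form of a `2 × 2` matrix. Expanding a bordered `3 × 3`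
determinant shows that extendable means that the form takes the value `1` modulo the determinant;
over a Hermite ring this improves to the value `1` itself (`IsHermiteRing.bilin_eq_one`). Over an
EDR every unimodular matrix attains `1`. Conversely, a Hermite ring is an EDR as soon as unimodular
upper triangular matrices attain `1` (`KaplanskyCondition`, `IsHermiteRing.isEDR`): the form of any
matrix then attains a common divisor of the entries, which can be moved to the corner and used to
clear its row and column. Any such triangular matrix yields a specialization of `matD` by scaling a
row and a column, so `matD` suffices (`IsHermiteRing.kaplanskyCondition`); `matF` reduces to `matD`
modulo its determinant. For Bézout domains, attaining `1` amounts to finding a matrix of rank at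
most one on a hyperplane. Parametrizing the hyperplane turns the vanishing of its determinant into
the stated equation. -/

theorem IsUnimodular.exists_fin_two {w : Fin 2 → R} (h : IsUnimodular R w) :
    ∃ x y : R, x * w 0 + y * w 1 = 1 := by
  obtain ⟨f, hf⟩ := h
  refine ⟨f (Pi.single 0 1), f (Pi.single 1 1), ?_⟩
  have hw : w = w 0 • Pi.single 0 1 + w 1 • Pi.single 1 1 := by
    ext i; fin_cases i <;> simp
  rw [hw, map_add, map_smul, map_smul, smul_eq_mul, smul_eq_mul] at hf
  linear_combination hf

theorem isUnimodular_matrix {A : Matrix (Fin 2) (Fin 2) R} (a b c d : R)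
    (h : a * A 0 0 + b * A 0 1 + c * A 1 0 + d * A 1 1 = 1) : IsUnimodular R A :=
  ⟨a • entryLinearMap R R 0 0 + b • entryLinearMap R R 0 1 + c • entryLinearMap R R 1 0 +
    d • entryLinearMap R R 1 1, by simpa using h⟩

theorem IsUnimodular.dvd_one {m n : Type*} [Fintype m] [Fintype n] [DecidableEq m]
    [DecidableEq n] {A : Matrix m n R} (h : IsUnimodular R A) {d : R}
    (hd : ∀ i j, d ∣ A i j) : d ∣ 1 := by
  obtain ⟨f, hf⟩ := h
  choose C hC using hd
  have hA : A = d • (Matrix.of C) := by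
    ext i j; simpa using hC i j
  exact ⟨f (Matrix.of C), by rw [← hf, hA, map_smul, smul_eq_mul]⟩

/-- In coordinates: every pair in a Hermite ring is a multiple of a unimodular pair. -/
theorem IsHermiteRing.exists_pair (h : IsHermiteRing R) (a b : R) :
    ∃ g a' b' x y : R, a = g * a' ∧ b = g * b' ∧ x * a' + y * b' = 1 := by
  obtain ⟨r, w, hw, hv⟩ := h ![a, b]
  obtain ⟨x, y, hxy⟩ := hw.exists_fin_two
  exact ⟨r, w 0, w 1, x, y, by simpa using congrFun hv 0, by simpa using congrFun hv 1, hxy⟩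

theorem isHermiteRing_of_isBezout [IsDomain R] [IsBezout R] : IsHermiteRing R := by
  intro v
  obtain ⟨g, hg⟩ := IsBezout.span_pair_isPrincipal (v 0) (v 1)
  have h0 : v 0 ∈ Ideal.span {v 0, v 1} := Ideal.subset_span (by simp)
  have h1 : v 1 ∈ Ideal.span {v 0, v 1} := Ideal.subset_span (by simp)
  have hgm : g ∈ Ideal.span {v 0, v 1} := by
    rw [hg]; exact Submodule.mem_span_singleton_self g
  rw [hg] at h0 h1
  obtain ⟨a, ha⟩ := Submodule.mem_span_singleton.1 h0
  obtain ⟨b, hb⟩ := Submodule.mem_span_singleton.1 h1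
  obtain ⟨x, y, hxy⟩ := Ideal.mem_span_pair.1 hgm
  simp only [smul_eq_mul] at ha hb
  by_cases h : g = 0
  · refine ⟨0, ![1, 0], ⟨LinearMap.proj 0, by simp⟩, ?_⟩
    ext i
    fin_cases i
    · simpa [h] using ha.symm
    · simpa [h] using hb.symm
  · refine ⟨g, ![a, b], ⟨x • LinearMap.proj 0 + y • LinearMap.proj 1, ?_⟩, ?_⟩
    · apply mul_left_cancel₀ h
      simp only [LinearMap.add_apply, LinearMap.smul_apply, LinearMap.proj_apply, smul_eq_mul,
        Matrix.cons_val_zero, Matrix.cons_val_one]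
      linear_combination hxy + x * ha + y * hb
    · ext i
      fin_cases i
      · simp [← ha, mul_comm]
      · simp [← hb, mul_comm]

/-! ### Extendability and the bilinear form of a matrix -/

/-- Extendable matrices are those whose bilinear form takes the value `1` modulo the
determinant. -/
theorem IsExtendable.exists_bilin {A : Matrix (Fin 2) (Fin 2) R} (h : IsExtendable A) :
    ∃ p q r s k : R,
      p * A 0 0 * r + p * A 0 1 * s + q * A 1 0 * r + q * A 1 1 * s =
        1 + k * (A 0 0 * A 1 1 - A 0 1 * A 1 0) := by
  obtain ⟨-, B, rfl⟩ := h
  have hB := B.det_coe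
  rw [det_fin_three] at hB
  -- Bordering `A` by a column `v`, a row `w` and a corner `t` gives determinant `t * det A - w *
  -- adj A * v`.
  refine ⟨B.1 1 2, -B.1 0 2, -B.1 2 1, B.1 2 0, -B.1 2 2, ?_⟩
  simp only [submatrix_apply, Fin.castSucc_zero, Fin.castSucc_one]
  linear_combination hB

theorem isExtendable_of_bilin {A : Matrix (Fin 2) (Fin 2) R} (p q r s : R)
    (h : p * A 0 0 * r + p * A 0 1 * s + q * A 1 0 * r + q * A 1 1 * s = 1) :
    IsExtendable A := by
  refine ⟨isUnimodular_matrix (p * r) (p * s) (q * r) (q * s) (by linear_combination h),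
    ⟨!![A 0 0, A 0 1, -q; A 1 0, A 1 1, p; s, -r, 0], ?_⟩, ?_⟩
  · simp [det_fin_three]
    linear_combination h
  · ext i j
    fin_cases i <;> fin_cases j <;> rfl

/-- Since Hermite rings have stable range at most two, a value `1` of the bilinear form modulo the
determinant lifts to a value `1`. -/
theorem IsHermiteRing.bilin_eq_one (h : IsHermiteRing R) {a b c d p q r s k : R}
    (e : p * a * r + p * b * s + q * c * r + q * d * s = 1 + k * (a * d - b * c)) :
    ∃ p q r s : R, p * a * r + p * b * s + q * c * r + q * d * s = 1 := by
  obtain ⟨g, e', f', x, y, he, hf, hxy⟩ := h.exists_pair (a * r + b * s) (c * r + d * s)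
  -- With `M` the given matrix, the new column vector adds `(-d * y - b * x, c * y + a * x)`, which
  -- moves its image under `M` from `g * (e', f')` to `g * (e', f') + det M * (-y, x)`. The row `(x,
  -- y)` kills the correction and `(f', -e')` kills `(e', f')`, so only `(p * e' + q * f') * g - k *
  -- det M = 1` remains.
  refine ⟨(p * e' + q * f') * x + k * f', (p * e' + q * f') * y - k * e',
    r - d * y - b * x, s + c * y + a * x, ?_⟩
  linear_combination e + ((p * e' + q * f') * x + k * f' - p) * he +
    ((p * e' + q * f') * y - k * e' - q) * hf +
    ((p * e' + q * f') * g - k * (a * d - b * c)) * hxy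

/-! ### Invertible matrices -/

theorem isUnit_of_mul_eq_one' {n : ℕ} {A B : Matrix (Fin n) (Fin n) R} (h : A * B = 1) :
    IsUnit A :=
  IsUnit.of_mul_eq_one B h

/-- The block diagonal matrix with blocks `(d)` and `A`. -/
def corner {m n : ℕ} (d : R) (A : Matrix (Fin m) (Fin n) R) :
    Matrix (Fin (m + 1)) (Fin (n + 1)) R :=
  Matrix.of (Fin.cons (Fin.cons d 0) fun i => Fin.cons 0 (A i))

section corner

variable {l m n : ℕ} (d e : R) (A : Matrix (Fin l) (Fin m) R) (B : Matrix (Fin m) (Fin n) R)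

@[simp] theorem corner_zero_zero : corner d A 0 0 = d := rfl

@[simp] theorem corner_zero_succ (j : Fin m) : corner d A 0 j.succ = 0 := rfl

@[simp] theorem corner_succ_zero (i : Fin l) : corner d A i.succ 0 = 0 := rfl

@[simp] theorem corner_succ_succ (i : Fin l) (j : Fin m) : corner d A i.succ j.succ = A i j := rfl

theorem corner_mul_corner : corner d A * corner e B = corner (d * e) (A * B) := by
  ext i j
  refine Fin.cases ?_ (fun i => ?_) i <;> refine Fin.cases ?_ (fun j => ?_) j <;>
    simp [Matrix.mul_apply, Fin.sum_univ_succ]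

theorem corner_one_one : corner (1 : R) (1 : Matrix (Fin n) (Fin n) R) = 1 := by
  ext i j
  refine Fin.cases ?_ (fun i => ?_) i <;> refine Fin.cases ?_ (fun j => ?_) j <;>
    simp [Matrix.one_apply, Fin.succ_ne_zero, (Fin.succ_ne_zero _).symm]

theorem isUnit_corner_one {P : Matrix (Fin n) (Fin n) R} (h : IsUnit P) :
    IsUnit (corner 1 P) := by
  obtain ⟨Q, hQ⟩ := h.exists_right_inv
  exact isUnit_of_mul_eq_one' (B := corner 1 Q) (by
    rw [corner_mul_corner, hQ, mul_one, corner_one_one])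

theorem corner_mulVec (v : Fin (m + 1) → R) :
    corner d A *ᵥ v = Fin.cons (d * v 0) (A *ᵥ Fin.tail v) := by
  ext i
  refine Fin.cases ?_ (fun i => ?_) i <;>
    simp [Matrix.mulVec, dotProduct, Fin.sum_univ_succ, Fin.tail]

end corner

/-- The identity matrix with its first column below the diagonal replaced by `c`. -/
def lowerColumn {n : ℕ} (c : Fin n → R) : Matrix (Fin (n + 1)) (Fin (n + 1)) R :=
  Matrix.of (Fin.cons (Fin.cons 1 0) fun i => Fin.cons (c i) ((1 : Matrix (Fin n) (Fin n) R) i))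

section lowerColumn

variable {n : ℕ} (c : Fin n → R)

@[simp] theorem lowerColumn_zero_zero : lowerColumn c 0 0 = 1 := rfl

@[simp] theorem lowerColumn_zero_succ (j : Fin n) : lowerColumn c 0 j.succ = 0 := rfl

@[simp] theorem lowerColumn_succ_zero (i : Fin n) : lowerColumn c i.succ 0 = c i := rfl

@[simp] theorem lowerColumn_succ_succ (i j : Fin n) :
    lowerColumn c i.succ j.succ = (1 : Matrix (Fin n) (Fin n) R) i j := rfl

theorem isUnit_lowerColumn : IsUnit (lowerColumn c) := by
  refine isUnit_of_mul_eq_one' (B := lowerColumn (-c)) ?_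
  rw [← corner_one_one]
  ext i j
  refine Fin.cases ?_ (fun i => ?_) i <;> refine Fin.cases ?_ (fun j => ?_) j <;>
    simp [Matrix.mul_apply, Fin.sum_univ_succ, Matrix.one_apply]

end lowerColumn

/-- The block diagonal matrix with a `2 × 2` block and an identity block. -/
def plane (n : ℕ) (a b c d : R) : Matrix (Fin (n + 2)) (Fin (n + 2)) R :=
  Matrix.of (Fin.cons (Fin.cons a (Fin.cons b 0))
    (Fin.cons (Fin.cons c (Fin.cons d 0))
      fun i => Fin.cons 0 (Fin.cons 0 ((1 : Matrix (Fin n) (Fin n) R) i))))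

theorem plane_mul_plane (n : ℕ) (a b c d a' b' c' d' : R) :
    plane n a b c d * plane n a' b' c' d' =
      plane n (a * a' + b * c') (a * b' + b * d') (c * a' + d * c') (c * b' + d * d') := by
  ext i j
  refine Fin.cases ?_ (fun i => Fin.cases ?_ (fun i => ?_) i) i <;>
    refine Fin.cases ?_ (fun j => Fin.cases ?_ (fun j => ?_) j) j <;>
    simp [Matrix.mul_apply, Fin.sum_univ_succ, plane, Matrix.one_apply]

theorem plane_one (n : ℕ) : plane n (1 : R) 0 0 1 = 1 := by
  rw [← corner_one_one, ← corner_one_one]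
  ext i j
  refine Fin.cases ?_ (fun i => Fin.cases ?_ (fun i => ?_) i) i <;>
    refine Fin.cases ?_ (fun j => Fin.cases ?_ (fun j => ?_) j) j <;> rfl

/-- Over a Hermite ring every vector is an invertible matrix away from a multiple of the first
basis vector. -/
theorem IsHermiteRing.exists_mulVec_eq_single (h : IsHermiteRing R) :
    ∀ (n : ℕ) (v : Fin (n + 1) → R), ∃ P : Matrix (Fin (n + 1)) (Fin (n + 1)) R,
      IsUnit P ∧ ∃ g : R, P *ᵥ v = Pi.single 0 g
  | 0, v => ⟨1, isUnit_one, v 0, by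
      ext i; rw [Fin.fin_one_eq_zero i]; simp⟩
  | n + 1, v => by
    obtain ⟨P, hP, g, hg⟩ := h.exists_mulVec_eq_single n (Fin.tail v)
    obtain ⟨k, a, b, x, y, ha, hb, hxy⟩ := h.exists_pair (v 0) g
    have hM : plane n x y (-b) a * plane n a (-y) b x = 1 := by
      rw [plane_mul_plane, ← plane_one]
      congr 1
      · ring
      · ring
      · linear_combination hxy
    refine ⟨plane n x y (-b) a * corner 1 P,
      (isUnit_of_mul_eq_one' hM).mul (isUnit_corner_one hP), k, ?_⟩
    rw [← mulVec_mulVec, corner_mulVec, hg]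
    ext i
    refine Fin.cases ?_ (fun i => Fin.cases ?_ (fun i => ?_) i) i
    · simp [Matrix.mulVec, dotProduct, Fin.sum_univ_succ, plane, Fin.succ_ne_zero]
      linear_combination x * ha + y * hb + k * hxy
    · simp [Matrix.mulVec, dotProduct, Fin.sum_univ_succ, plane, Fin.succ_ne_zero]
      linear_combination a * hb - b * ha
    · simp [Matrix.mulVec, dotProduct, Fin.sum_univ_succ, plane, Fin.succ_ne_zero]

/-! ### Pivots -/

theorem dvd_mul_mul {l m n o : Type*} [Fintype m] [Fintype n] {d : R}
    (P : Matrix l m R) {A : Matrix m n R} (Q : Matrix n o R) (h : ∀ i j, d ∣ A i j) (i : l)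
    (j : o) : d ∣ (P * A * Q) i j := by
  simp only [Matrix.mul_apply]
  exact Finset.dvd_sum fun k _ => Dvd.dvd.mul_right
    (Finset.dvd_sum fun x _ => Dvd.dvd.mul_left (h x k) _) _

/-- The bilinear form of the matrix takes a value dividing all entries. -/
def HasPivot {m n : Type*} [Fintype m] [Fintype n] (A : Matrix m n R) : Prop :=
  ∃ (w : m → R) (v : n → R), ∀ i j, w ⬝ᵥ A *ᵥ v ∣ A i j

theorem HasPivot.transpose {m n : Type*} [Fintype m] [Fintype n] {A : Matrix m n R}
    (h : HasPivot A) : HasPivot Aᵀ := by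
  obtain ⟨w, v, hwv⟩ := h
  refine ⟨v, w, fun i j => ?_⟩
  rw [mulVec_transpose, dotProduct_comm, ← dotProduct_mulVec]
  exact hwv j i

/-- Pivots of matrices with two rows give pivots of matrices with any number of rows. -/
theorem hasPivot_of_two_rows {n : Type*} [Fintype n]
    (h : ∀ A : Matrix (Fin 2) n R, HasPivot A) :
    ∀ (m : ℕ) (A : Matrix (Fin m) n R), HasPivot A
  | 0, _ => ⟨0, 0, fun i => i.elim0⟩
  | m + 1, A => by
    obtain ⟨w, v, hwv⟩ := hasPivot_of_two_rows h m (A.submatrix Fin.succ id)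
    -- The lower rows are replaced by their combination with coefficients `w`. A divisor of that row
    -- divides its pairing with `v`, hence every lower entry.
    obtain ⟨w', v', hwv'⟩ := h (Matrix.of ![A 0, w ᵥ* A.submatrix Fin.succ id])
    have key : (Fin.cons (w' 0) (w' 1 • w) : Fin (m + 1) → R) ⬝ᵥ A *ᵥ v' =
        w' ⬝ᵥ Matrix.of ![A 0, w ᵥ* A.submatrix Fin.succ id] *ᵥ v' := by
      have e : (w ᵥ* A.submatrix Fin.succ id) ⬝ᵥ v' = ∑ i, w i * (A i.succ ⬝ᵥ v') := by
        rw [← dotProduct_mulVec]; rfl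
      simp only [dotProduct, Fin.sum_univ_succ, Fin.cons_zero, Fin.cons_succ] at e ⊢
      simp only [mulVec, Matrix.of_apply, Matrix.cons_val_zero, dotProduct, Fin.succ_zero_eq_one,
        Matrix.cons_val_one, Pi.smul_apply, smul_eq_mul, Finset.univ_eq_empty,
        Finset.sum_empty, add_zero, e, Finset.mul_sum, mul_assoc]
    refine ⟨Fin.cons (w' 0) (w' 1 • w), v', fun i j => ?_⟩
    rw [key]
    refine Fin.cases (by simpa using hwv' 0 j) (fun i => ?_) i
    refine dvd_trans ?_ (hwv i j)
    rw [dotProduct_mulVec w]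
    exact Finset.dvd_sum fun k _ => Dvd.dvd.mul_right (by simpa using hwv' 1 k) _

theorem hasPivot_of_two_by_two (h : ∀ A : Matrix (Fin 2) (Fin 2) R, HasPivot A) (m n : ℕ)
    (A : Matrix (Fin m) (Fin n) R) : HasPivot A :=
  hasPivot_of_two_rows (fun B => by
    simpa using (hasPivot_of_two_rows h n Bᵀ).transpose) m A

/-- Kaplansky's condition on unimodular triples. -/
def KaplanskyCondition (R : Type*) [CommRing R] : Prop :=
  ∀ a b c α β γ : R, α * a + β * b + γ * c = 1 →
    ∃ p q r s : R, p * a * r + p * b * s + q * c * s = 1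

/-- The column operation `[d, x; -c, y]`, of determinant `1`, makes the matrix upper triangular.
Extracting contents leaves `t` times a unimodular triangular matrix, whose form attains `1`; thus
`t` is the pivot. -/
theorem IsHermiteRing.hasPivot_two_by_two (h : IsHermiteRing R) (hK : KaplanskyCondition R)
    (A : Matrix (Fin 2) (Fin 2) R) : HasPivot A := by
  obtain ⟨g, c, d, x, y, hc, hd, hxy⟩ := h.exists_pair (A 1 0) (A 1 1)
  obtain ⟨k, a', b', x', y', ha, hb, hxy'⟩ :=
    h.exists_pair (A 0 0 * d - A 0 1 * c) (A 0 0 * x + A 0 1 * y)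
  obtain ⟨t, k', g', x'', y'', hk, hg, hxy''⟩ := h.exists_pair k g
  obtain ⟨p, q, r, s, e⟩ := hK (k' * a') (k' * b') g' (x'' * x') (x'' * y') y''
    (by linear_combination x'' * k' * hxy' + hxy'')
  have key : ![p, q] ⬝ᵥ A *ᵥ ![d * r + x * s, y * s - c * r] = t := by
    simp only [Matrix.mulVec, dotProduct, Fin.sum_univ_two, Matrix.cons_val_zero,
      Matrix.cons_val_one]
    linear_combination t * e + p * r * ha + p * s * hb + q * s * g * hxy +
      q * (d * r + x * s) * hc + q * (y * s - c * r) * hd + p * r * a' * hk + p * s * b' * hk +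
      q * s * hg
  refine ⟨![p, q], ![d * r + x * s, y * s - c * r], ?_⟩
  rw [key]
  have h00 : t ∣ A 0 0 := ⟨k' * (a' * y + b' * c), by
    linear_combination (-A 0 0) * hxy + y * ha + c * hb + (a' * y + b' * c) * hk⟩
  have h01 : t ∣ A 0 1 := ⟨k' * (b' * d - a' * x), by
    linear_combination (-A 0 1) * hxy - x * ha + d * hb + (b' * d - a' * x) * hk⟩
  have h10 : t ∣ A 1 0 := ⟨g' * c, by linear_combination hc + c * hg⟩
  have h11 : t ∣ A 1 1 := ⟨g' * d, by linear_combination hd + d * hg⟩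
  intro i j
  fin_cases i <;> fin_cases j <;> assumption

/-! ### Diagonal reduction -/

/-- In bases where `w` and `v` are multiples of the first basis vector, the pivot is a multiple of
the corner entry. That entry therefore divides all others and clears its row and column. -/
theorem IsHermiteRing.exists_corner (h : IsHermiteRing R) {m n : ℕ}
    (A : Matrix (Fin (m + 1)) (Fin (n + 1)) R) (hA : HasPivot A) :
    ∃ (P : Matrix (Fin (m + 1)) (Fin (m + 1)) R) (Q : Matrix (Fin (n + 1)) (Fin (n + 1)) R)
      (d : R) (B : Matrix (Fin m) (Fin n) R), IsUnit P ∧ IsUnit Q ∧ P * A * Q = corner d B ∧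
        ∀ i j, d ∣ B i j := by
  obtain ⟨w, v, hwv⟩ := hA
  obtain ⟨P, hP, g, hg⟩ := h.exists_mulVec_eq_single m w
  obtain ⟨Q, hQ, k, hk⟩ := h.exists_mulVec_eq_single n v
  obtain ⟨P', hP'⟩ := hP.exists_left_inv
  obtain ⟨Q', hQ'⟩ := hQ.exists_left_inv
  have hw : w = P' *ᵥ Pi.single 0 g := by rw [← hg, mulVec_mulVec, hP', one_mulVec]
  have hv : v = Q' *ᵥ Pi.single 0 k := by rw [← hk, mulVec_mulVec, hQ', one_mulVec]
  have hval : w ⬝ᵥ A *ᵥ v = (P'ᵀ * A * Q') 0 0 * (g * k) := by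
    have e : w ⬝ᵥ A *ᵥ v = Pi.single 0 g ⬝ᵥ (P'ᵀ * A * Q') *ᵥ Pi.single 0 k := by
      rw [← mulVec_mulVec, ← hv, ← mulVec_mulVec, dotProduct_mulVec _ P'ᵀ, vecMul_transpose, ← hw]
    rw [e, single_dotProduct, mulVec_single]
    simp
    ring
  set C := P'ᵀ * A * Q' with hC
  have hdvd : ∀ i j, C 0 0 ∣ C i j := fun i j =>
    dvd_mul_mul _ _ (fun i j => dvd_trans ⟨g * k, hval⟩ (hwv i j)) i j
  choose E hE using hdvd
  have hL : lowerColumn (fun i => -E i.succ 0) * C * (lowerColumn fun j => -E 0 j.succ)ᵀ =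
      corner (C 0 0) (Matrix.of fun i j => C i.succ j.succ - C 0 0 * E i.succ 0 * E 0 j.succ) := by
    ext i j
    refine Fin.cases ?_ (fun i => ?_) i <;> refine Fin.cases ?_ (fun j => ?_) j
    · simp [Matrix.mul_apply, Fin.sum_univ_succ]
    · simp [Matrix.mul_apply, Fin.sum_univ_succ, Matrix.one_apply]
      linear_combination hE 0 j.succ
    · simp [Matrix.mul_apply, Fin.sum_univ_succ, Matrix.one_apply]
      linear_combination hE i.succ 0
    · simp [Matrix.mul_apply, Fin.sum_univ_succ, Matrix.one_apply]
      linear_combination -E 0 j.succ * hE i.succ 0 - E i.succ 0 * hE 0 j.succ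
  refine ⟨lowerColumn (fun i => -E i.succ 0) * P'ᵀ, Q' * (lowerColumn fun j => -E 0 j.succ)ᵀ,
    C 0 0, Matrix.of fun i j => C i.succ j.succ - C 0 0 * E i.succ 0 * E 0 j.succ,
    (isUnit_lowerColumn _).mul ?_, IsUnit.mul ?_ ?_, ?_, ?_⟩
  · exact (isUnit_transpose P').2 (isUnit_of_mul_eq_one' hP')
  · exact isUnit_of_mul_eq_one' hQ'
  · exact (isUnit_transpose _).2 (isUnit_lowerColumn _)
  · rw [← hL, hC]
    simp only [Matrix.mul_assoc]
  · intro i j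
    exact dvd_sub ⟨_, hE _ _⟩ ((dvd_mul_right _ _).mul_right _)

theorem isDivisorDiagonal_corner {m n : ℕ} {d : R} {B : Matrix (Fin m) (Fin n) R}
    (hB : IsDivisorDiagonal B) (hd : ∀ i j, d ∣ B i j) : IsDivisorDiagonal (corner d B) := by
  constructor
  · intro i j
    refine Fin.cases ?_ (fun i => ?_) i <;> refine Fin.cases ?_ (fun j => ?_) j
    · simp
    · simp
    · simp
    · intro hij
      exact hB.1 i j (by simpa using hij)
  · rintro (_ | k) hm hn
    · exact hd ⟨0, by omega⟩ ⟨0, by omega⟩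
    · exact hB.2 k (by omega) (by omega)

theorem IsHermiteRing.exists_isDivisorDiagonal (h : IsHermiteRing R)
    (hp : ∀ (m n : ℕ) (A : Matrix (Fin m) (Fin n) R), HasPivot A) :
    ∀ (m n : ℕ) (A : Matrix (Fin m) (Fin n) R), ∃ (P : Matrix (Fin m) (Fin m) R)
      (Q : Matrix (Fin n) (Fin n) R), IsUnit P ∧ IsUnit Q ∧ IsDivisorDiagonal (P * A * Q)
  | 0, _, _ => ⟨1, 1, isUnit_one, isUnit_one, fun i => i.elim0, fun _ hm => by omega⟩
  | _ + 1, 0, _ => ⟨1, 1, isUnit_one, isUnit_one, fun _ j => j.elim0, fun _ _ hn => by omega⟩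
  | m + 1, n + 1, A => by
    obtain ⟨P, Q, d, B, hP, hQ, hB, hd⟩ := h.exists_corner A (hp _ _ A)
    obtain ⟨P', Q', hP', hQ', hD⟩ := h.exists_isDivisorDiagonal hp m n B
    refine ⟨corner 1 P' * P, Q * corner 1 Q', (isUnit_corner_one hP').mul hP,
      hQ.mul (isUnit_corner_one hQ'), ?_⟩
    have e : corner 1 P' * P * A * (Q * corner 1 Q') = corner d (P' * B * Q') := by
      calc _ = corner 1 P' * (P * A * Q) * corner 1 Q' := by simp only [Matrix.mul_assoc]
        _ = _ := by rw [hB, corner_mul_corner, corner_mul_corner, one_mul, mul_one]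
    rw [e]
    exact isDivisorDiagonal_corner hD (dvd_mul_mul _ _ hd)

/-- A Hermite ring satisfying Kaplansky's condition is an elementary divisor ring. -/
theorem IsHermiteRing.isEDR (h : IsHermiteRing R) (hK : KaplanskyCondition R) : IsEDR R := by
  intro m n _ _ A
  obtain ⟨P, Q, hP, hQ, hD⟩ := h.exists_isDivisorDiagonal
    (hasPivot_of_two_by_two (h.hasPivot_two_by_two hK)) m n A
  exact ⟨hP.unit, hQ.unit, hD⟩

/-- Unimodularity survives equivalence, so the first diagonal entry of the reduced form is a unit.
-/
theorem IsEDR.exists_bilin_eq_one (h : IsEDR R) {A : Matrix (Fin 2) (Fin 2) R}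
    (hA : IsUnimodular R A) :
    ∃ p q r s : R, p * A 0 0 * r + p * A 0 1 * s + q * A 1 0 * r + q * A 1 1 * s = 1 := by
  obtain ⟨P, Q, hoff, hdiv⟩ := h 2 2 (by norm_num) (by norm_num) A
  set D := (P : Matrix (Fin 2) (Fin 2) R) * A * (Q : Matrix (Fin 2) (Fin 2) R) with hD
  have h01 : D 0 1 = 0 := hoff 0 1 (by simp)
  have h10 : D 1 0 = 0 := hoff 1 0 (by simp)
  have h11 : D 0 0 ∣ D 1 1 := hdiv 0 (by norm_num) (by norm_num)
  have hall : ∀ i j, D 0 0 ∣ D i j := by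
    intro i j
    fin_cases i <;> fin_cases j
    · exact dvd_rfl
    · exact h01 ▸ dvd_zero _
    · exact h10 ▸ dvd_zero _
    · exact h11
  have hAD : A = ((P⁻¹ : GeneralLinearGroup (Fin 2) R) : Matrix (Fin 2) (Fin 2) R) * D *
      ((Q⁻¹ : GeneralLinearGroup (Fin 2) R) : Matrix (Fin 2) (Fin 2) R) := by
    rw [hD, Matrix.mul_assoc, Matrix.mul_assoc, Units.mul_inv, Matrix.mul_one, ← Matrix.mul_assoc,
      Units.inv_mul, Matrix.one_mul]
  obtain ⟨u, hu⟩ := hA.dvd_one (d := D 0 0) (by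
    rw [hAD]; exact dvd_mul_mul _ _ hall)
  refine ⟨u * P.1 0 0, u * P.1 0 1, Q.1 0 0, Q.1 1 0, ?_⟩
  rw [hu, hD]
  simp only [Matrix.mul_apply, Fin.sum_univ_two]
  ring

theorem IsEDR.isExtendable (h : IsEDR R) {A : Matrix (Fin 2) (Fin 2) R}
    (hA : IsUnimodular R A) : IsExtendable A := by
  obtain ⟨p, q, r, s, e⟩ := h.exists_bilin_eq_one hA
  exact isExtendable_of_bilin p q r s e

/-! ### The test matrices -/

theorem map_matD (φ : Zxyz →+* R) :
    matD.map φ = !![φ varX * (1 - φ varY * φ varZ), φ varY;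
      0, (1 - φ varX) * (1 - φ varY * φ varZ)] := by
  ext i j
  fin_cases i <;> fin_cases j <;> simp [matD]

theorem map_matF (φ : Zxyz →+* R) :
    matF.map φ = !![φ varX, φ varY; 0, (1 - φ varX) * (1 - φ varY * φ varZ)] := by
  ext i j
  fin_cases i <;> fin_cases j <;> simp [matF]

theorem exists_eval (x y z : R) :
    ∃ φ : Zxyz →+* R, φ varX = x ∧ φ varY = y ∧ φ varZ = z :=
  ⟨MvPolynomial.eval₂Hom (Int.castRingHom R) ![x, y, z], by simp [varX], by simp [varY],
    by simp [varZ]⟩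

theorem isUnimodular_testD (x y z : R) :
    IsUnimodular R !![x * (1 - y * z), y; 0, (1 - x) * (1 - y * z)] :=
  isUnimodular_matrix 1 z 0 1 (by simp; ring)

theorem isUnimodular_testF (x y z : R) :
    IsUnimodular R !![x, y; 0, (1 - x) * (1 - y * z)] :=
  isUnimodular_matrix 1 ((1 - x) * z) 0 1 (by simp; ring)

/-- It suffices to check Kaplansky's condition on the first family of test matrices. -/
theorem IsHermiteRing.kaplanskyCondition (h : IsHermiteRing R)
    (hD : ∀ x y z : R, ∃ p q r s : R,
      p * (x * (1 - y * z)) * r + p * y * s + q * ((1 - x) * (1 - y * z)) * s = 1) :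
    KaplanskyCondition R := by
  intro a b c α β γ e
  obtain ⟨g, a', c', x, y, ha, hc, hxy⟩ := h.exists_pair a c
  -- With `m = α * a' + γ * c'`, the test matrix at `(x * a', b, β)` is `[a, b; 0, c]` with first
  -- column scaled by `x * m` and second row by `y * m`; these factors are absorbed into `r` and
  -- `q`.
  obtain ⟨p, q, r, s, e'⟩ := hD (x * a') b β
  refine ⟨p, q * y * (α * a' + γ * c'), x * (α * a' + γ * c') * r, s, ?_⟩
  have hg : 1 - b * β = g * (α * a' + γ * c') := by
    linear_combination -e + α * ha + γ * hc
  have hx : 1 - x * a' = y * c' := by linear_combination -hxy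
  rw [hg, hx] at e'
  rw [ha, hc]
  linear_combination e'

theorem IsHermiteRing.isEDR_of_matD (h : IsHermiteRing R)
    (hD : ∀ φ : Zxyz →+* R, IsExtendable (matD.map φ)) : IsEDR R := by
  refine h.isEDR (h.kaplanskyCondition fun x y z => ?_)
  obtain ⟨φ, rfl, rfl, rfl⟩ := exists_eval x y z
  have e := hD φ
  rw [map_matD] at e
  obtain ⟨p, q, r, s, k, e⟩ := e.exists_bilin
  obtain ⟨p, q, r, s, e⟩ := h.bilin_eq_one e
  exact ⟨p, q, r, s, by simpa using e⟩

theorem IsHermiteRing.isEDR_of_matF (h : IsHermiteRing R)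
    (hF : ∀ φ : Zxyz →+* R, IsExtendable (matF.map φ)) : IsEDR R := by
  refine h.isEDR (h.kaplanskyCondition fun x y z => ?_)
  obtain ⟨φ, rfl, rfl, rfl⟩ := exists_eval x y z
  have e := hF φ
  rw [map_matF] at e
  obtain ⟨p, q, r, s, k, e⟩ := e.exists_bilin
  generalize φ varX = x at *
  generalize φ varY = y at *
  generalize φ varZ = z at *
  simp only [Matrix.of_apply, Matrix.cons_val', Matrix.cons_val_zero, Matrix.cons_val_one,
    Matrix.cons_val_fin_one] at e
  -- the two test matrices are equivalent modulo the determinant `f` of the second one,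
  -- whose square is divisible by the determinant of the first one
  obtain ⟨f, hf⟩ : ∃ f, f = x * ((1 - x) * (1 - y * z)) := ⟨_, rfl⟩
  obtain ⟨k', hk'⟩ : ∃ k', k' = k + q * z * r := ⟨_, rfl⟩
  -- Replacing `s` by `s + x * z * r` gives the first test matrix the value `1 + k' * f`.
  -- Multiplying by `1 - k' * f` leaves `1 - k' ^ 2 * f ^ 2`, and `f ^ 2` is `x * (1 - x)` times its
  -- determinant.
  obtain ⟨p, q, r, s, e⟩ := h.bilin_eq_one (a := x * (1 - y * z)) (b := y) (c := 0)
    (d := (1 - x) * (1 - y * z)) (p := (1 - k' * f) * p) (q := (1 - k' * f) * q) (r := r)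
    (s := s + x * z * r) (k := -k' ^ 2 * (x * (1 - x))) (by
      subst hf hk'
      linear_combination (1 - (k + q * z * r) * (x * ((1 - x) * (1 - y * z)))) * e)
  exact ⟨p, q, r, s, by linear_combination e⟩

/-! ### The equation over Bézout domains -/

/-- With `b₁₁ = q * s`, `b₁₁ + l = p * r` and `b₂₁ = p * s`, the hypothesis reads `(1 - u * t) *
(b₁₁ + a * l) + u * b₂₁ = 1`. Its solutions are `(b₁₁ + a * l, b₂₁) = (1, t) + s' * (-u, 1 - u *
t)`, with `s' = b₂₁ - t * (b₁₁ + a * l)`. The equation to solve is then `b₁₁ * (b₁₁ + l) = b₂₁ * z`.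
-/
theorem exists_solution_of_bilin {a u t p q r s : R}
    (e : p * (a * (1 - u * t)) * r + p * u * s + q * ((1 - a) * (1 - u * t)) * s = 1) :
    ∃ s l z : R,
      (1 - u * s - a * l) ^ 2 + l - u * s * l - a * l ^ 2 - (s + t - u * s * t) * z = 0 := by
  have e₁ : 1 - u * (p * s - t * (a * (p * r) + (1 - a) * (q * s))) - a * (p * r - q * s) =
      q * s := by
    linear_combination -e
  have e₂ : (p * s - t * (a * (p * r) + (1 - a) * (q * s))) + t -
      u * (p * s - t * (a * (p * r) + (1 - a) * (q * s))) * t = p * s := by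
    linear_combination -t * e
  refine ⟨p * s - t * (a * (p * r) + (1 - a) * (q * s)), p * r - q * s, q * r, ?_⟩
  rw [e₁, e₂]
  linear_combination (p * r - q * s) * e₁

/-- A solution is a `2 × 2` matrix of determinant zero. Over a Hermite domain it factors as a column
times a row, once the content `g` of `(b₁₁, b₂₁)` can be cancelled. -/
theorem exists_bilin_of_solution [IsDomain R] (h : IsHermiteRing R) {a u t s l z : R}
    (e : (1 - u * s - a * l) ^ 2 + l - u * s * l - a * l ^ 2 - (s + t - u * s * t) * z = 0) :
    ∃ p q r s : R,
      p * (a * (1 - u * t)) * r + p * u * s + q * ((1 - a) * (1 - u * t)) * s = 1 := by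
  obtain ⟨b₁₁, h₁⟩ : ∃ b, b = 1 - u * s - a * l := ⟨_, rfl⟩
  obtain ⟨b₂₁, h₂⟩ : ∃ b, b = s + t - u * s * t := ⟨_, rfl⟩
  have hdet : b₁₁ * (b₁₁ + l) = b₂₁ * z := by
    subst h₁ h₂; linear_combination e
  have hlin : (1 - a) * (1 - u * t) * b₁₁ + u * b₂₁ + a * (1 - u * t) * (b₁₁ + l) = 1 := by
    subst h₁ h₂; ring
  obtain ⟨g, q, p, x, y, hq, hp, hxy⟩ := h.exists_pair b₁₁ b₂₁
  by_cases hg : g = 0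
  -- Here `b₁₁ = b₂₁ = 0`, so the linear relation alone gives the value `1`.
  · refine ⟨1, 0, b₁₁ + l, 0, ?_⟩
    rw [hg] at hq hp
    linear_combination hlin - (1 - a) * (1 - u * t) * hq - u * hp
  · have hz : q * (b₁₁ + l) = p * z := by
      apply mul_left_cancel₀ hg
      linear_combination hdet - (b₁₁ + l) * hq + z * hp
    -- This choice of `r` satisfies `q * r = z` and `p * r = b₁₁ + l`.
    refine ⟨p, q, x * z + y * (b₁₁ + l), g, ?_⟩
    linear_combination hlin - a * (1 - u * t) * x * hz + a * (1 - u * t) * (b₁₁ + l) * hxy -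
      u * hp - (1 - a) * (1 - u * t) * hq

end HermiteExt

theorem corollaryC4 (R : Type*) [CommRing R] :
    (HermiteExt.IsUnimodular HermiteExt.Zxyz HermiteExt.matD ∧
      HermiteExt.IsUnimodular HermiteExt.Zxyz HermiteExt.matF) ∧
    (HermiteExt.IsHermiteRing R →
      (HermiteExt.IsEDR R ↔
        ∀ φ : HermiteExt.Zxyz →+* R, HermiteExt.IsExtendable (HermiteExt.matD.map φ)) ∧
      (HermiteExt.IsEDR R ↔
        ∀ φ : HermiteExt.Zxyz →+* R, HermiteExt.IsExtendable (HermiteExt.matF.map φ))) ∧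
    (IsDomain R → IsBezout R →
      (HermiteExt.IsEDD R ↔
        ∀ a u t : R, u ≠ 0 → ∃ s l z : R,
          (1 - u * s - a * l) ^ 2 + l - u * s * l - a * l ^ 2 - (s + t - u * s * t) * z = 0)) := by
  refine ⟨⟨HermiteExt.isUnimodular_testD _ _ _, HermiteExt.isUnimodular_testF _ _ _⟩,
    fun h => ⟨⟨fun hE φ => ?_, h.isEDR_of_matD⟩, ⟨fun hE φ => ?_, h.isEDR_of_matF⟩⟩,
    fun _ _ => ?_⟩
  · rw [HermiteExt.map_matD]
    exact hE.isExtendable (HermiteExt.isUnimodular_testD _ _ _)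
  · rw [HermiteExt.map_matF]
    exact hE.isExtendable (HermiteExt.isUnimodular_testF _ _ _)
  · have h : HermiteExt.IsHermiteRing R := HermiteExt.isHermiteRing_of_isBezout
    constructor
    · rintro ⟨-, hE⟩ a u t -
      obtain ⟨p, q, r, s, e⟩ := hE.exists_bilin_eq_one (HermiteExt.isUnimodular_testD a u t)
      exact HermiteExt.exists_solution_of_bilin (p := p) (q := q) (r := r) (s := s)
        (by simpa using e)
    · intro H
      refine ⟨inferInstance, h.isEDR (h.kaplanskyCondition fun x y z => ?_)⟩
      by_cases hy : y = 0
      -- The case excluded by `u ≠ 0`: the test matrix is `diag(x, 1 - x)`, whose trace is `1`.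
      · exact ⟨1, 1, 1, 1, by rw [hy]; ring⟩
      · obtain ⟨s, l, w, e⟩ := H x y z hy
        exact HermiteExt.exists_bilin_of_solution h e
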